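/- A \emph{Lie skew brace} is a triple $(G,\cdot,\circ)$ in which $(G,\cdot)$ and $(G,\circ)$ are (finite-dimensional, smooth) real Lie groups on the same smooth manifold $G$ and $a\circ(b\cdot c)=(a\circ b)\cdot a^{-1}\cdot(a\circ c)$ for all $a,b,c\in G$, where $a^{-1}$ is the inverse of $a$ in $(G,\cdot)$. The two groups then have the same identity $e$. Put $\lambda_a(b)=a^{-1}\cdot(a\circ b)$ and $x*y=\lambda_x(y)\cdot y^{-1}$. An \emph{ideal} is a connected closed Lie subgroup $I\subseteq G$ that is normal in $(G,\cdot)$ and in $(G,\circ)$ and satisfies $\lambda_a(I)=I$ for all $a\in G$. For ideals $I,J$ of $G$, let $[I,J]_B$ be the closed connected ideal generated by all commutators $[x,y]_\cdot$, all commutators $[x,y]_\circ$ and all star products $x*y$ with $x\in I$, $y\in J$. For connected $G$, put $\partial^0(G)=G$ and $\partial^{n+1}(G)=[\partial^n(G),\partial^n(G)]_B$; $G$ is \emph{solvable} if $\partial^n(G)=\{e\}$ for some $n\ge 0$. \textbf{Corollary.} Let $(G,\cdot,\circ)$ be a connected compact Lie skew brace which is solvable. Then there is an integer $n\ge 0$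 such that, as Lie groups, \[ (G,\cdot)\cong(G,\circ)\cong\mathbb T^n . \] Moreover, the Lie skew brace is trivial, that is, $a\circ b=a\cdot b$ for all $a,b\in G$. -/

import Mathlib

open scoped Manifold ContDiff

/-- A skew (left) brace: two group structures on the same set, the additive group `(G, ·)`
(the `Group G` instance, written multiplicatively) and the multiplicative group `(G, ∘)`
(`circGroup`), with `a ∘ (b · c) = (a ∘ b) · a⁻¹ · (a ∘ c)`, where `a⁻¹` is the inverse
in `(G, ·)`. -/
class SkewBrace (G : Type*) extends Group G where
  circGroup : Group G
  circ_mul : ∀ a b c : G,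
    circGroup.mul a (b * c) = circGroup.mul a b * a⁻¹ * circGroup.mul a c

namespace SkewBrace

section Algebra

variable {G : Type*} [SkewBrace G]

/-- The second operation `a ∘ b`. -/
def circ (a b : G) : G := (circGroup : Group G).mul a b

/-- The inverse of `a` in `(G, ∘)`. -/
def circInv (a : G) : G := (circGroup : Group G).inv a

/-- The lambda-action `λ_a(b) = a⁻¹ · (a ∘ b)`. -/
def lam (a b : G) : G := a⁻¹ * circ a b

/-- The star product `x * y = λ_x(y) · y⁻¹`. -/
def star (x y : G) : G := lam x y * y⁻¹

/-- The commutator `x ∘ y ∘ x̄ ∘ ȳ` in `(G, ∘)`. -/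
def circCommutator (x y : G) : G := circ (circ (circ x y) (circInv x)) (circInv y)

/-- All commutators in `(G, ·)`, all commutators in `(G, ∘)` and all star products of elements
`x ∈ I`, `y ∈ J`. -/
def bracketGenerators (I J : Set G) : Set G :=
  {g | ∃ x ∈ I, ∃ y ∈ J, g = x * y * x⁻¹ * y⁻¹ ∨ g = circCommutator x y ∨ g = star x y}

variable (G) in
/-- The brace is trivial if the two operations coincide. -/
def IsTrivial : Prop := ∀ a b : G, circ a b = a * b

end Algebra

section Topology

variable {G : Type*} [SkewBrace G] [TopologicalSpace G]

/-- An ideal in the Lie sense: a connected closed subgroup, normal in `(G, ·)` and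
in `(G, ∘)`, and with `λ_a(I) = I` for all `a`. (In a Lie group the closed Lie subgroups are
exactly the closed subgroups.) -/
structure IsIdeal (I : Subgroup G) : Prop where
  isClosed : IsClosed (I : Set G)
  isConnected : IsConnected (I : Set G)
  normal : I.Normal
  circ_mem : ∀ a ∈ I, ∀ b ∈ I, circ a b ∈ I
  circInv_mem : ∀ a ∈ I, circInv a ∈ I
  circ_conj_mem : ∀ a ∈ I, ∀ g : G, circ (circ g a) (circInv g) ∈ I
  lam_image : ∀ a : G, lam a '' (I : Set G) = I

/-- `[I, J]_B`: the closed connected ideal generated by the commutators (for both operations) and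
the star products of elements of `I` and `J`, that is, the intersection of all ideals that
contain them. For ideals `I`, `J` the set of generators is a union of connected sets
through `e`, so the subgroup it generates under all the ideal operations is connected, its
closure is an ideal, and the intersection is this ideal, the least one. -/
def bracket (I J : Subgroup G) : Subgroup G :=
  sInf {K : Subgroup G | IsIdeal K ∧ bracketGenerators (I : Set G) (J : Set G) ⊆ K}

variable (G) in
/-- The derived series `∂⁰(G) = G`, `∂ⁿ⁺¹(G) = [∂ⁿ(G), ∂ⁿ(G)]_B`. -/
def derived : ℕ → Subgroup G
  | 0 => ⊤
  | n + 1 => bracket (derived n) (derived n)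

variable (G) in
/-- The brace is solvable if `∂ⁿ(G) = {e}` for some `n`. -/
def IsBraceSolvable : Prop := ∃ n : ℕ, derived G n = ⊥

end Topology

end SkewBrace

/-- A Lie skew brace: a skew brace on a finite-dimensional smooth manifold `G`, modelled on the
real vector space `E`, such that `(G, ·)` and `(G, ∘)` are both (smooth) Lie groups. -/
class LieSkewBrace (E : Type*) [NormedAddCommGroup E] [NormedSpace ℝ E] [FiniteDimensional ℝ E]
    (G : Type*) [TopologicalSpace G] [ChartedSpace E G] [SkewBrace G] : Prop where
  lieGroup : LieGroup 𝓘(ℝ, E) ∞ G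
  lieGroup_circ : @LieGroup ℝ _ E _ E _ _ 𝓘(ℝ, E) ∞ G SkewBrace.circGroup _ _

/-- The torus `𝕋ⁿ`, a product of `n` copies of the Lie group of unit complex numbers. -/
abbrev Torus (n : ℕ) : Type := Fin n → Circle

/-- The model with corners of `𝕋ⁿ` for its product manifold structure. -/
noncomputable abbrev torusModel (n : ℕ) :
    ModelWithCorners ℝ (Fin n → EuclideanSpace ℝ (Fin 1))
      (ModelPi fun _ : Fin n => EuclideanSpace ℝ (Fin 1)) :=
  ModelWithCorners.pi fun _ : Fin n => 𝓡 1

/-!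
The closed derived series of `(G, ·)` is contained in the derived series of the brace, so `(G, ·)` is
a compact connected Lie group whose closed derived series reaches the trivial group. Everything then
rests on a rigidity principle (`NoSmallSubgroups.monoidHom_eq`): a Lie group has no small subgroups
(`noSmallSubgroups_of_lieGroup`), so homomorphisms from a compact group into it with commuting values
form a discrete family, and a continuous family of them over a connected space is constant.

* Applied to conjugation on the last nontrivial term of the closed derived series, and then to the
  commutator maps `[h, ·]`, rigidity shows that `(G, ·)` is commutative
  (`NoSmallSubgroups.mul_comm_of_closedDerivedSeries_eq_bot`).
* Applied to the family `λ_a` of endomorphisms of `(G, ·)`, it shows that `λ_a = λ_e = id`, that is,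
  `a ∘ b = a · b`.

It remains to see that a compact connected commutative Lie group is a torus
(`exists_diffeomorph_torus`). Every tangent vector at the identity generates a smooth one-parameter
subgroup (`exists_oneParameterSubgroup`), and the product of those in the directions of a basis is a
smooth homomorphism from the model space to the group, a local diffeomorphism at the origin by the
inverse function theorem (`exists_isExponential`). It is surjective by connectedness, and by
compactness its kernel is a lattice (`IsExponential.exists_basis_kernel`).
-/

open Set Filter Topology

/-! ### Rigidity of homomorphisms into groups without small subgroups -/

/-- A topological group has no small subgroups if some neighbourhood of the identity contains no
nontrivial subgroup. -/
def NoSmallSubgroups (G : Type*) [Group G] [TopologicalSpace G] : Prop :=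
  ∃ U ∈ 𝓝 (1 : G), ∀ H : Subgroup G, (H : Set G) ⊆ U → H = ⊥

/-- Homomorphisms from a compact group into a group without small subgroups, with commuting values,
cannot be deformed: the quotient of two uniformly close ones is a homomorphism with small image. -/
theorem NoSmallSubgroups.monoidHom_eq {X K G : Type*} [TopologicalSpace X] [PreconnectedSpace X]
    [TopologicalSpace K] [CompactSpace K] [Group K] [Group G] [TopologicalSpace G]
    [IsTopologicalGroup G] (hG : NoSmallSubgroups G) (F : X → K →* G)
    (hF : Continuous fun p : X × K => F p.1 p.2)
    (hc : ∀ x y k l, Commute (F x k) (F y l)) (x y : X) : F x = F y := by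
  obtain ⟨U, hU, hUs⟩ := hG
  refine IsLocallyConstant.apply_eq_of_preconnectedSpace (f := F) ?_ x y
  rw [IsLocallyConstant.iff_eventually_eq]
  intro x₀
  have key : ∀ᶠ x in 𝓝 x₀, ∀ k ∈ (univ : Set K), F x k * (F x₀ k)⁻¹ ∈ U := by
    refine isCompact_univ.eventually_forall_of_forall_eventually fun k _ => ?_
    have hcont : Continuous fun p : X × K => F p.1 p.2 * (F x₀ p.2)⁻¹ :=
      hF.mul (hF.comp (continuous_const.prodMk continuous_snd)).inv
    refine hcont.continuousAt.preimage_mem_nhds ?_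
    simpa using hU
  filter_upwards [key] with z hz
  -- `k ↦ F z k / F x₀ k` is a homomorphism, since the values commute
  let D : K →* G :=
    { toFun := fun k => F z k * (F x₀ k)⁻¹
      map_one' := by simp
      map_mul' := fun k l => by
        have h1 : F z l * (F x₀ k)⁻¹ = (F x₀ k)⁻¹ * F z l := ((hc z x₀ l k).inv_right).eq
        have h2 : (F x₀ l)⁻¹ * (F x₀ k)⁻¹ = (F x₀ k)⁻¹ * (F x₀ l)⁻¹ :=
          ((hc x₀ x₀ l k).inv_inv).eq
        simp only [map_mul, mul_inv_rev]
        rw [h2, mul_assoc, ← mul_assoc (F z l), h1]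
        simp only [mul_assoc] }
  have hD : D.range = ⊥ := hUs _ (by rintro _ ⟨k, rfl⟩; exact hz k (mem_univ k))
  ext k
  have : D k ∈ D.range := ⟨k, rfl⟩
  rw [hD, Subgroup.mem_bot] at this
  exact mul_inv_eq_one.1 this

/-! ### Compact connected solvable groups without small subgroups are commutative -/

/-- By rigidity, `H` acts trivially on `A` by conjugation, so that `k ↦ [h, k]` is a homomorphism
for every `h ∈ H`; by rigidity again it does not depend on `h`. -/
theorem NoSmallSubgroups.commute_of_commutator_mem {G : Type*} [Group G] [TopologicalSpace G]
    [IsTopologicalGroup G] (hG : NoSmallSubgroups G) {H A : Subgroup G}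
    (hHc : IsCompact (H : Set G)) (hHconn : IsPreconnected (H : Set G))
    (hAc : IsCompact (A : Set G)) (hA : ∀ a ∈ A, ∀ b ∈ A, Commute a b)
    (hHA : ∀ x ∈ H, ∀ y ∈ H, x * y * x⁻¹ * y⁻¹ ∈ A) (hAH : A ≤ H) :
    ∀ x ∈ H, ∀ y ∈ H, Commute x y := by
  have : CompactSpace H := isCompact_iff_compactSpace.1 hHc
  have : CompactSpace A := isCompact_iff_compactSpace.1 hAc
  have : PreconnectedSpace H := Subtype.preconnectedSpace hHconn
  have hconj : ∀ h ∈ H, ∀ a ∈ A, h * a * h⁻¹ ∈ A := fun h hh a ha => by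
    simpa using A.mul_mem (hHA h hh a (hAH ha)) ha
  let C : H → A →* G := fun h => (MulAut.conj (h : G)).toMonoidHom.comp A.subtype
  have hC : ∀ h : H, C h = C 1 := fun h => by
    refine hG.monoidHom_eq C ?_ ?_ h 1
    · change Continuous fun p : H × A => (p.1 : G) * p.2 * (p.1 : G)⁻¹
      fun_prop
    · intro x y k l
      exact hA _ (hconj _ x.2 _ k.2) _ (hconj _ y.2 _ l.2)
  have hcentral : ∀ h ∈ H, ∀ a ∈ A, h * a = a * h := fun h hh a ha => by
    have h1 := DFunLike.congr_fun (hC ⟨h, hh⟩) ⟨a, ha⟩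
    have h2 : h * a * h⁻¹ = 1 * a * 1⁻¹ := h1
    rw [mul_inv_eq_iff_eq_mul] at h2
    simpa using h2
  let F : H → H →* G := fun h =>
    { toFun := fun k => (h : G) * k * (h : G)⁻¹ * (k : G)⁻¹
      map_one' := by simp
      map_mul' := fun k l => by
        have h1 := hcentral k k.2 _ (hHA h h.2 l l.2)
        calc (h : G) * (k * l : H) * (h : G)⁻¹ * ((k * l : H) : G)⁻¹
            = h * k * (h : G)⁻¹ * (h * l * (h : G)⁻¹ * (l : G)⁻¹) * (k : G)⁻¹ := by
              push_cast; group
          _ = h * k * (h : G)⁻¹ * (k : G)⁻¹ * (k * (h * l * (h : G)⁻¹ * (l : G)⁻¹))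
                * (k : G)⁻¹ := by group
          _ = _ := by rw [h1]; group }
  have hF : ∀ h : H, F h = F 1 := fun h => by
    refine hG.monoidHom_eq F ?_ ?_ h 1
    · change Continuous fun p : H × H => (p.1 : G) * p.2 * (p.1 : G)⁻¹ * (p.2 : G)⁻¹
      fun_prop
    · intro x y k l
      exact hA _ (hHA _ x.2 _ k.2) _ (hHA _ y.2 _ l.2)
  intro x hx y hy
  have h1 := DFunLike.congr_fun (hF ⟨x, hx⟩) ⟨y, hy⟩
  have h2 : x * y * x⁻¹ * y⁻¹ = 1 * y * 1⁻¹ * y⁻¹ := h1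
  have h3 : x * y * x⁻¹ * y⁻¹ = 1 := by simpa using h2
  rw [mul_inv_eq_one, mul_inv_eq_iff_eq_mul] at h3
  exact h3

/-- The subgroup generated by a preconnected set through the identity is preconnected. -/
theorem Subgroup.isPreconnected_closure {G : Type*} [Group G] [TopologicalSpace G]
    [IsTopologicalGroup G] {S : Set G} (hS : IsPreconnected S) (h1 : (1 : G) ∈ S) :
    IsPreconnected (Subgroup.closure S : Set G) := by
  let L := Subgroup.closure S
  -- the identity component of `L` contains the generators, hence is all of `L`
  let C : Subgroup L := Subgroup.connectedComponentOfOne L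
  have hSL : S ⊆ L := Subgroup.subset_closure
  have hT : IsPreconnected ((↑) ⁻¹' S : Set L) := by
    refine (IsInducing.isPreconnected_image (f := (Subtype.val : L → G)) .subtypeVal).1 ?_
    have : (Subtype.val '' ((↑) ⁻¹' S : Set L) : Set G) = S := by
      ext g
      exact ⟨by rintro ⟨z, hz, rfl⟩; exact hz, fun hg => ⟨⟨g, hSL hg⟩, hg, rfl⟩⟩
    rwa [this]
  have hTC : ((↑) ⁻¹' S : Set L) ⊆ connectedComponent (1 : L) :=
    hT.subset_connectedComponent h1
  have hle : L ≤ C.map L.subtype := by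
    rw [Subgroup.closure_le]
    exact fun s hs => ⟨⟨s, hSL hs⟩, hTC hs, rfl⟩
  have : (L : Set G) = (↑) '' connectedComponent (1 : L) := by
    refine Subset.antisymm hle ?_
    rintro _ ⟨z, -, rfl⟩
    exact z.2
  change IsPreconnected (L : Set G)
  rw [this]
  exact isPreconnected_connectedComponent.image _ continuous_subtype_val.continuousOn

section ClosedDerivedSeries

open scoped commutatorElement

variable {G : Type*} [Group G] [TopologicalSpace G] [IsTopologicalGroup G]

variable (G) in
/-- The closed derived series: every term is the closure of the commutator subgroup of the
previous one. -/
def closedDerivedSeries : ℕ → Subgroup G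
  | 0 => ⊤
  | n + 1 => ⁅closedDerivedSeries n, closedDerivedSeries n⁆.topologicalClosure

theorem commutator_mem_closedDerivedSeries_succ {n : ℕ} {x y : G}
    (hx : x ∈ closedDerivedSeries G n) (hy : y ∈ closedDerivedSeries G n) :
    x * y * x⁻¹ * y⁻¹ ∈ closedDerivedSeries G (n + 1) :=
  Subgroup.le_topologicalClosure _ (Subgroup.commutator_mem_commutator hx hy)

theorem isClosed_closedDerivedSeries (n : ℕ) : IsClosed (closedDerivedSeries G n : Set G) := by
  cases n with
  | zero => exact isClosed_univ
  | succ n => exact Subgroup.isClosed_topologicalClosure _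

theorem closedDerivedSeries_succ_le (n : ℕ) :
    closedDerivedSeries G (n + 1) ≤ closedDerivedSeries G n := by
  refine Subgroup.topologicalClosure_minimal _ ?_ (isClosed_closedDerivedSeries n)
  exact Subgroup.commutator_le.2 fun x hx y hy => by
    rw [commutatorElement_def]
    exact mul_mem (mul_mem (mul_mem hx hy) (inv_mem hx)) (inv_mem hy)

theorem isPreconnected_closedDerivedSeries [PreconnectedSpace G] (n : ℕ) :
    IsPreconnected (closedDerivedSeries G n : Set G) := by
  induction n with
  | zero => exact isPreconnected_univ
  | succ n ih =>
    have hS : IsPreconnected {g : G | ∃ x ∈ closedDerivedSeries G n,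
        ∃ y ∈ closedDerivedSeries G n, ⁅x, y⁆ = g} := by
      have : {g : G | ∃ x ∈ closedDerivedSeries G n, ∃ y ∈ closedDerivedSeries G n, ⁅x, y⁆ = g}
          = (fun p : G × G => p.1 * p.2 * p.1⁻¹ * p.2⁻¹) ''
            ((closedDerivedSeries G n : Set G) ×ˢ (closedDerivedSeries G n : Set G)) := by
        ext g
        simp only [mem_ofPred_eq, mem_image, mem_prod, Prod.exists, SetLike.mem_coe,
          commutatorElement_def]
        constructor
        · rintro ⟨x, hx, y, hy, h⟩
          exact ⟨x, y, ⟨hx, hy⟩, h⟩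
        · rintro ⟨x, y, ⟨hx, hy⟩, h⟩
          exact ⟨x, hx, y, hy, h⟩
      rw [this]
      exact (ih.prod ih).image _ (by fun_prop)
    have := (Subgroup.isPreconnected_closure hS ⟨1, one_mem _, 1, one_mem _, by simp⟩).closure
    exact this

/-- The last nontrivial term `A` of the closed derived series is commutative; if it is not the
first one, then the term before it is commutative as well, so that `A` is trivial. -/
theorem NoSmallSubgroups.mul_comm_of_closedDerivedSeries_eq_bot [CompactSpace G]
    [PreconnectedSpace G] (hG : NoSmallSubgroups G) [T1Space G] {n : ℕ}
    (hn : closedDerivedSeries G n = ⊥) (x y : G) : x * y = y * x := by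
  have hcomm : ∀ m, closedDerivedSeries G (m + 1) = ⊥ →
      ∀ a ∈ closedDerivedSeries G m, ∀ b ∈ closedDerivedSeries G m, Commute a b := by
    intro m hm a ha b hb
    have := commutator_mem_closedDerivedSeries_succ ha hb
    rw [hm, Subgroup.mem_bot, mul_inv_eq_one, mul_inv_eq_iff_eq_mul] at this
    exact this
  have step : ∀ m, closedDerivedSeries G (m + 2) = ⊥ → closedDerivedSeries G (m + 1) = ⊥ := by
    intro m hm
    have h := hG.commute_of_commutator_mem (isClosed_closedDerivedSeries m).isCompact
      (isPreconnected_closedDerivedSeries m) (isClosed_closedDerivedSeries (m + 1)).isCompact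
      (hcomm (m + 1) hm) (fun x hx y hy => commutator_mem_closedDerivedSeries_succ hx hy)
      (closedDerivedSeries_succ_le m)
    rw [eq_bot_iff]
    refine Subgroup.topologicalClosure_minimal _ ?_ (by simp)
    exact Subgroup.commutator_le.2 fun x hx y hy => by
      rw [Subgroup.mem_bot, commutatorElement_eq_one_iff_mul_comm]
      exact h x hx y hy
  have h1 : ∀ m, closedDerivedSeries G (m + 1) = ⊥ → closedDerivedSeries G 1 = ⊥ := by
    intro m
    induction m with
    | zero => exact id
    | succ m ih => exact fun h => ih (step m h)
  have h2 : closedDerivedSeries G 1 = ⊥ :=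
    h1 n (eq_bot_iff.2 (hn ▸ closedDerivedSeries_succ_le n))
  exact hcomm 0 h2 x trivial y trivial

end ClosedDerivedSeries

/-! ### The multiplication of a Lie group in a chart at the identity -/

section LieGroupChart

variable (E : Type*) [NormedAddCommGroup E] [NormedSpace ℝ E]
  (G : Type*) [TopologicalSpace G] [ChartedSpace E G] [Group G]

/-- The preferred chart at the identity of a Lie group modelled on `E`. -/
noncomputable abbrev oneChart : PartialEquiv G E := extChartAt 𝓘(ℝ, E) (1 : G)

/-- The multiplication of a Lie group read in the chart at the identity. -/
noncomputable def chartMul (p : E × E) : E :=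
  oneChart E G ((oneChart E G).symm p.1 * (oneChart E G).symm p.2)

variable {E G}

theorem one_mem_oneChart_source : (1 : G) ∈ (oneChart E G).source :=
  mem_extChartAt_source (I := 𝓘(ℝ, E)) (1 : G)

theorem oneChart_one_mem_target : oneChart E G 1 ∈ (oneChart E G).target :=
  (oneChart E G).map_source one_mem_oneChart_source

theorem isOpen_oneChart_target : IsOpen (oneChart E G).target :=
  isOpen_extChartAt_target (I := 𝓘(ℝ, E)) (1 : G)

theorem isOpen_oneChart_source : IsOpen (oneChart E G).source :=
  isOpen_extChartAt_source (I := 𝓘(ℝ, E)) (1 : G)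

theorem oneChart_symm_oneChart_one : (oneChart E G).symm (oneChart E G 1) = 1 :=
  (oneChart E G).left_inv one_mem_oneChart_source

theorem chartMul_oneChart {a b : G} (ha : a ∈ (oneChart E G).source)
    (hb : b ∈ (oneChart E G).source) :
    chartMul E G (oneChart E G a, oneChart E G b) = oneChart E G (a * b) := by
  simp only [chartMul]
  rw [(oneChart E G).left_inv ha, (oneChart E G).left_inv hb]

theorem chartMul_one_right {x : E} (hx : x ∈ (oneChart E G).target) :
    chartMul E G (x, oneChart E G 1) = x := by
  simp only [chartMul]
  rw [oneChart_symm_oneChart_one, mul_one, (oneChart E G).right_inv hx]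

theorem chartMul_one_left {x : E} (hx : x ∈ (oneChart E G).target) :
    chartMul E G (oneChart E G 1, x) = x := by
  simp only [chartMul]
  rw [oneChart_symm_oneChart_one, one_mul, (oneChart E G).right_inv hx]

variable [LieGroup 𝓘(ℝ, E) ∞ G]

theorem contMDiffAt_oneChart_symm {x : E} (hx : x ∈ (oneChart E G).target) :
    ContMDiffAt 𝓘(ℝ, E) 𝓘(ℝ, E) ∞ (oneChart E G).symm x :=
  (contMDiffOn_extChartAt_symm (I := 𝓘(ℝ, E)) (n := ∞) (1 : G)).contMDiffAt
    (isOpen_oneChart_target.mem_nhds hx)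

theorem contMDiffAt_oneChart {g : G} (hg : g ∈ (oneChart E G).source) :
    ContMDiffAt 𝓘(ℝ, E) 𝓘(ℝ, E) ∞ (oneChart E G) g :=
  contMDiffAt_extChartAt' (by rwa [← extChartAt_source 𝓘(ℝ, E)])

theorem contDiffAt_chartMul {p : E × E} (h1 : p.1 ∈ (oneChart E G).target)
    (h2 : p.2 ∈ (oneChart E G).target)
    (h : (oneChart E G).symm p.1 * (oneChart E G).symm p.2 ∈ (oneChart E G).source) :
    ContDiffAt ℝ ∞ (chartMul E G) p := by
  rw [← contMDiffAt_iff_contDiffAt]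
  have f1 : ContMDiffAt 𝓘(ℝ, E × E) 𝓘(ℝ, E) ∞ (fun p : E × E => (oneChart E G).symm p.1) p :=
    (contMDiffAt_oneChart_symm h1).comp p contDiff_fst.contMDiff.contMDiffAt
  have f2 : ContMDiffAt 𝓘(ℝ, E × E) 𝓘(ℝ, E) ∞ (fun p : E × E => (oneChart E G).symm p.2) p :=
    (contMDiffAt_oneChart_symm h2).comp p contDiff_snd.contMDiff.contMDiffAt
  exact (contMDiffAt_oneChart h).comp p (f1.mul f2)

theorem contDiffAt_chartMul_right {x : E} (hx : x ∈ (oneChart E G).target) :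
    ContDiffAt ℝ ∞ (chartMul E G) (x, oneChart E G 1) := by
  refine contDiffAt_chartMul (G := G) hx (oneChart_one_mem_target (E := E) (G := G)) ?_
  simp only
  rw [oneChart_symm_oneChart_one, mul_one]
  exact (oneChart E G).map_target hx

/-- Since `m(x, 1) = x = m(1, x)`, the multiplication has derivative `(u, v) ↦ u + v` at the
identity. -/
theorem hasFDerivAt_chartMul_one :
    HasFDerivAt (chartMul E G)
      (ContinuousLinearMap.fst ℝ E E + ContinuousLinearMap.snd ℝ E E)
      (oneChart E G 1, oneChart E G 1) := by
  set c := oneChart E G 1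
  have hM := ((contDiffAt_chartMul_right (oneChart_one_mem_target (E := E) (G := G))).differentiableAt
    (by simp)).hasFDerivAt
  set M := fderiv ℝ (chartMul E G) (c, c)
  have hnear : ∀ᶠ x in 𝓝 c, x ∈ (oneChart E G).target :=
    isOpen_oneChart_target.mem_nhds oneChart_one_mem_target
  have h1 : M.comp (ContinuousLinearMap.inl ℝ E E) = ContinuousLinearMap.id ℝ E := by
    have h : HasFDerivAt (fun x : E => chartMul E G (x, c))
        (M.comp (ContinuousLinearMap.inl ℝ E E)) c :=
      HasFDerivAt.comp (g := chartMul E G) c hM (hasFDerivAt_prodMk_left c c)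
    refine h.unique ((hasFDerivAt_id c).congr_of_eventuallyEq ?_)
    filter_upwards [hnear] with x hx using chartMul_one_right hx
  have h2 : M.comp (ContinuousLinearMap.inr ℝ E E) = ContinuousLinearMap.id ℝ E := by
    have h : HasFDerivAt (fun x : E => chartMul E G (c, x))
        (M.comp (ContinuousLinearMap.inr ℝ E E)) c :=
      HasFDerivAt.comp (g := chartMul E G) c hM (hasFDerivAt_prodMk_right c c)
    refine h.unique ((hasFDerivAt_id c).congr_of_eventuallyEq ?_)
    filter_upwards [hnear] with x hx using chartMul_one_left hx
  have : M = ContinuousLinearMap.fst ℝ E E + ContinuousLinearMap.snd ℝ E E := by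
    refine ContinuousLinearMap.ext fun p => ?_
    have e1 : M (p.1, 0) = p.1 := DFunLike.congr_fun h1 p.1
    have e2 : M (0, p.2) = p.2 := DFunLike.congr_fun h2 p.2
    have : p = (p.1, 0) + (0, p.2) := by simp
    rw [this, map_add, e1, e2]
    simp
  rwa [this] at hM

end LieGroupChart

/-- The squaring map has derivative `2` at the identity, so that in a chart it moves points away
from the identity; a point of a small subgroup other than the identity would have to leave the
neighbourhood after finitely many squarings. -/
theorem noSmallSubgroups_of_lieGroup (E : Type*) [NormedAddCommGroup E] [NormedSpace ℝ E]
    (G : Type*) [TopologicalSpace G] [ChartedSpace E G] [Group G] [LieGroup 𝓘(ℝ, E) ∞ G] :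
    NoSmallSubgroups G := by
  have : IsTopologicalGroup G := topologicalGroup_of_lieGroup 𝓘(ℝ, E) ∞
  set c := oneChart E G 1 with hc
  have hs : HasFDerivAt (fun x : E => chartMul E G (x, x))
      ((ContinuousLinearMap.fst ℝ E E + ContinuousLinearMap.snd ℝ E E).comp
        ((ContinuousLinearMap.id ℝ E).prod (ContinuousLinearMap.id ℝ E))) c :=
    HasFDerivAt.comp (g := chartMul E G) c hasFDerivAt_chartMul_one
      ((hasFDerivAt_id c).prodMk (hasFDerivAt_id c))
  have hlo := hs.isLittleO.def (c := 1 / 2) (by norm_num)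
  obtain ⟨δ, hδ, hball⟩ := Metric.eventually_nhds_iff.1 hlo
  have hgrow : ∀ x : E, dist x c < δ →
      3 / 2 * ‖x - c‖ ≤ ‖chartMul E G (x, x) - c‖ := by
    intro x hx
    have h1 := hball hx
    rw [chartMul_one_right oneChart_one_mem_target] at h1
    simp only [ContinuousLinearMap.comp_apply, ContinuousLinearMap.prod_apply,
      add_apply, ContinuousLinearMap.id_apply,
      ContinuousLinearMap.coe_fst', ContinuousLinearMap.coe_snd'] at h1
    have h2 : ‖(x - c) + (x - c)‖ = 2 * ‖x - c‖ := by
      rw [← two_smul ℝ, norm_smul]; simp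
    have h3 := norm_sub_norm_le ((x - c) + (x - c)) (chartMul E G (x, x) - c)
    rw [norm_sub_rev (x - c + (x - c))] at h3
    change ‖chartMul E G (x, x) - c - ((x - c) + (x - c))‖ ≤ _ at h1
    linarith
  have hcont : ContinuousAt (oneChart E G) 1 :=
    (contMDiffAt_oneChart one_mem_oneChart_source).continuousAt
  -- in this neighbourhood every squaring stretches the distance to the identity by `3 / 2`
  refine ⟨(oneChart E G).source ∩ oneChart E G ⁻¹' Metric.ball c δ,
    inter_mem (isOpen_oneChart_source.mem_nhds one_mem_oneChart_source)
      (hcont.preimage_mem_nhds (Metric.ball_mem_nhds c hδ)), fun H hH => ?_⟩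
  rw [eq_bot_iff]
  intro h hh
  have hpow : ∀ k : ℕ, (3 / 2 : ℝ) ^ k * ‖oneChart E G h - c‖ ≤ ‖oneChart E G (h ^ 2 ^ k) - c‖ := by
    intro k
    induction k with
    | zero => simp
    | succ k ih =>
      have hk := hH (H.pow_mem hh (2 ^ k))
      have := hgrow _ hk.2
      rw [chartMul_oneChart hk.1 hk.1, ← pow_add, ← two_mul, ← pow_succ'] at this
      rw [pow_succ']
      linarith
  have hzero : ‖oneChart E G h - c‖ = 0 := by
    by_contra hne
    have hpos : 0 < ‖oneChart E G h - c‖ := lt_of_le_of_ne (norm_nonneg _) (Ne.symm hne)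
    obtain ⟨k, hk⟩ := pow_unbounded_of_one_lt (δ / ‖oneChart E G h - c‖)
      (by norm_num : (1 : ℝ) < 3 / 2)
    have h1 := (hH (H.pow_mem hh (2 ^ k))).2
    have h2 : ‖oneChart E G (h ^ 2 ^ k) - c‖ < δ := by
      simpa [dist_eq_norm] using h1
    rw [div_lt_iff₀ hpos] at hk
    linarith [hpow k]
  have h1 : oneChart E G h = oneChart E G 1 := sub_eq_zero.1 (norm_eq_zero.1 hzero)
  exact (oneChart E G).injOn (hH hh).1 one_mem_oneChart_source h1

theorem t2Space_of_lieGroup (E : Type*) [NormedAddCommGroup E] [NormedSpace ℝ E]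
    (G : Type*) [TopologicalSpace G] [ChartedSpace E G] [Group G] [LieGroup 𝓘(ℝ, E) ∞ G] : T2Space G := by
  have : IsTopologicalGroup G := topologicalGroup_of_lieGroup 𝓘(ℝ, E) ∞
  have : T1Space G := 𝓘(ℝ, E).t1Space G
  infer_instance

/-! ### One-parameter subgroups -/

section OneParameter

variable {E : Type*} [NormedAddCommGroup E] [NormedSpace ℝ E]
  {G : Type*} [TopologicalSpace G] [ChartedSpace E G] [Group G] [LieGroup 𝓘(ℝ, E) ∞ G]

/-- A homomorphism from a vector space to a Lie group that is smooth at the origin is smooth. -/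
theorem contMDiff_of_map_add_of_contMDiffAt_zero {V : Type*} [NormedAddCommGroup V]
    [NormedSpace ℝ V] {f : V → G} (hf : ∀ x y, f (x + y) = f x * f y)
    (h0 : ContMDiffAt 𝓘(ℝ, V) 𝓘(ℝ, E) ∞ f 0) : ContMDiff 𝓘(ℝ, V) 𝓘(ℝ, E) ∞ f := by
  intro x
  have h1 : ContMDiffAt 𝓘(ℝ, V) 𝓘(ℝ, V) ∞ (fun y : V => y - x) x :=
    (contDiff_id.sub contDiff_const).contMDiff.contMDiffAt
  have h2 : ContMDiffAt 𝓘(ℝ, V) 𝓘(ℝ, E) ∞ (fun y : V => f (y - x)) x :=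
    ContMDiffAt.comp x (by simpa using h0) h1
  have h3 := (contMDiffAt_const (c := f x)).mul h2
  refine h3.congr_of_eventuallyEq (Eventually.of_forall fun y => ?_)
  change f y = f x * f (y - x)
  rw [← hf, add_sub_cancel]

/-- In a chart, a one-parameter subgroup `γ` satisfies the ordinary differential equation
`γ' = D₂m(γ, 1) v`, whose right-hand side is a smooth function of `γ`, so that `γ` is smooth. -/
theorem contMDiff_of_map_add_of_hasDerivAt_zero {γ : ℝ → G} {v : E}
    (hγ : ∀ s t, γ (s + t) = γ s * γ t) (hcont : Continuous γ)
    (hv : HasDerivAt (fun t => oneChart E G (γ t)) v 0) :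
    ContMDiff 𝓘(ℝ, ℝ) 𝓘(ℝ, E) ∞ γ := by
  have hγ0 : γ 0 = 1 := by
    have := hγ 0 0
    rw [add_zero] at this
    exact left_eq_mul.1 this
  set c := oneChart E G 1 with hc
  set I : Set ℝ := γ ⁻¹' (oneChart E G).source
  have hI : IsOpen I := isOpen_oneChart_source.preimage hcont
  have h0 : (0 : ℝ) ∈ I := by
    change γ 0 ∈ (oneChart E G).source
    rw [hγ0]; exact one_mem_oneChart_source
  set f : ℝ → E := fun t => oneChart E G (γ t) with hf
  have hfI : ∀ t ∈ I, f t ∈ (oneChart E G).target := fun t ht => (oneChart E G).map_source ht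
  have hf0 : f 0 = c := by simp only [hf, hγ0, hc]
  let V : E → E := fun x => fderiv ℝ (chartMul E G) (x, c) (0, v)
  have hV : ContDiffOn ℝ ∞ V (oneChart E G).target := by
    intro x hx
    have h1 : ContDiffAt ℝ ∞ (fderiv ℝ (chartMul E G)) (x, c) :=
      (contDiffAt_chartMul_right hx).fderiv_right (by simp)
    have h2 : ContDiffAt ℝ ∞ (fun x : E => fderiv ℝ (chartMul E G) (x, c)) x :=
      ContDiffAt.comp (g := fderiv ℝ (chartMul E G)) x h1
        (contDiff_id.prodMk contDiff_const).contDiffAt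
    exact (h2.clm_apply contDiffAt_const).contDiffWithinAt
  -- differentiate `f s = m (f t, f (s - t))` at `s = t`
  have hderiv : ∀ t ∈ I, HasDerivAt f (V (f t)) t := by
    intro t ht
    have hM := ((contDiffAt_chartMul_right (hfI t ht)).differentiableAt (by simp)).hasFDerivAt
    have h1 : HasDerivAt (fun s : ℝ => (f t, f (s - t))) ((0 : E), v) t := by
      refine (hasDerivAt_const t (f t)).prodMk ?_
      have : HasDerivAt f v (t - t) := by rw [sub_self]; exact hv
      simpa using this.comp_sub_const t t
    have h2 : HasDerivAt (fun s : ℝ => chartMul E G (f t, f (s - t))) (V (f t)) t := by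
      refine HasFDerivAt.comp_hasDerivAt (l := chartMul E G) t ?_ h1
      simpa only [sub_self, hf0] using hM
    refine h2.congr_of_eventuallyEq ?_
    have hnear : ∀ᶠ s in 𝓝 t, s - t ∈ I := by
      have : Tendsto (fun s : ℝ => s - t) (𝓝 t) (𝓝 (t - t)) :=
        (continuous_id.sub continuous_const).tendsto t
      rw [sub_self] at this
      exact this.eventually (hI.mem_nhds h0)
    filter_upwards [hnear] with s hs
    rw [hf, chartMul_oneChart ht hs, ← hγ, add_sub_cancel]
  -- if `f` is of class `C^n`, then so is `f' = V ∘ f`, so `f` is of class `C^(n+1)`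
  have hsmooth : ∀ n : ℕ, ContDiffOn ℝ n f I := by
    intro n
    induction n with
    | zero =>
      rw [Nat.cast_zero, contDiffOn_zero]
      exact fun t ht => (hderiv t ht).continuousAt.continuousWithinAt
    | succ n ih =>
      rw [Nat.cast_succ, contDiffOn_succ_iff_deriv_of_isOpen hI]
      refine ⟨fun t ht => (hderiv t ht).differentiableAt.differentiableWithinAt, by simp, ?_⟩
      have : ContDiffOn ℝ n (fun t => V (f t)) I :=
        ContDiffOn.comp (hV.of_le (by exact_mod_cast le_top)) ih hfI
      exact this.congr fun t ht => (hderiv t ht).deriv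
  refine contMDiff_of_map_add_of_contMDiffAt_zero hγ ?_
  have h1 : ContMDiffAt 𝓘(ℝ, ℝ) 𝓘(ℝ, E) ∞ f 0 :=
    ((contDiffOn_infty.2 hsmooth).contDiffAt (hI.mem_nhds h0)).contMDiffAt
  have h2 := (contMDiffAt_oneChart_symm (hfI 0 h0)).comp 0 h1
  refine h2.congr_of_eventuallyEq ?_
  filter_upwards [hI.mem_nhds h0] with t ht
  exact ((oneChart E G).left_inv ht).symm

theorem mfderiv_mul_left_mulInvariantVectorField (v : GroupLieAlgebra 𝓘(ℝ, E) G) (g h : G) :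
    mfderiv 𝓘(ℝ, E) 𝓘(ℝ, E) (g * ·) h (mulInvariantVectorField v h) =
      mulInvariantVectorField v (g * h) := by
  have hd : ∀ a b : G, MDifferentiableAt 𝓘(ℝ, E) 𝓘(ℝ, E) (a * ·) b := fun a b =>
    (contMDiffAt_mul_left (n := ∞)).mdifferentiableAt (by simp)
  have hcomp : ((g * h) * · : G → G) = (g * ·) ∘ (h * ·) := by
    ext x; simp [mul_assoc]
  have key := mfderiv_comp_apply_of_eq (1 : G) (hd g h) (hd h 1) (mul_one h) v
  rw [← hcomp] at key
  exact key.symm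

/-- Left translates of integral curves of a left-invariant vector field are integral curves. -/
theorem IsMIntegralCurveOn.const_mul {v : GroupLieAlgebra 𝓘(ℝ, E) G} {γ : ℝ → G} {s : Set ℝ}
    (hγ : IsMIntegralCurveOn γ (mulInvariantVectorField v) s) (g : G) :
    IsMIntegralCurveOn (fun t => g * γ t) (mulInvariantVectorField v) s := by
  intro t ht
  have h1 : HasMFDerivAt 𝓘(ℝ, E) 𝓘(ℝ, E) (g * ·) (γ t)
      (mfderiv 𝓘(ℝ, E) 𝓘(ℝ, E) (g * ·) (γ t)) :=
    ((contMDiffAt_mul_left (n := ∞)).mdifferentiableAt (by simp)).hasMFDerivAt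
  refine (h1.comp_hasMFDerivWithinAt t (hγ t ht)).congr_mfderiv ?_
  rw [← mfderiv_mul_left_mulInvariantVectorField]
  refine ContinuousLinearMap.ext fun x => ?_
  exact (mfderiv 𝓘(ℝ, E) 𝓘(ℝ, E) (g * ·) (γ t)).map_smul _ _

/-- Every tangent vector at the identity of a Lie group is the velocity of a smooth one-parameter
subgroup. Integral curves of the left-invariant vector field exist for a time that does not depend
on the starting point, since they are translates of each other, hence for all times. -/
theorem exists_oneParameterSubgroup [CompleteSpace E] (v : E) :
    ∃ γ : ℝ → G, ContMDiff 𝓘(ℝ, ℝ) 𝓘(ℝ, E) ∞ γ ∧ (∀ s t, γ (s + t) = γ s * γ t) ∧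
      HasDerivAt (fun t => oneChart E G (γ t)) v 0 := by
  have : T2Space G := t2Space_of_lieGroup E G
  have : LieGroup 𝓘(ℝ, E) (minSmoothness ℝ 3) G :=
    LieGroup.of_le (n := ∞) (by rw [minSmoothness_of_isRCLikeNormedField]; exact ENat.LEInfty.out)
  have : IsManifold 𝓘(ℝ, E) 1 G := IsManifold.of_le (n := ∞) (by exact_mod_cast le_top)
  let X : (g : G) → TangentSpace 𝓘(ℝ, E) g :=
    mulInvariantVectorField (I := 𝓘(ℝ, E)) (G := G) (show GroupLieAlgebra 𝓘(ℝ, E) G from v)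
  have hX : ContMDiff 𝓘(ℝ, E) 𝓘(ℝ, E).tangent 1
      (fun g : G => (⟨g, X g⟩ : TangentBundle 𝓘(ℝ, E) G)) :=
    (contMDiff_mulInvariantVectorField (I := 𝓘(ℝ, E)) (G := G) v).of_le (by
      rw [minSmoothness_of_isRCLikeNormedField]; norm_num)
  obtain ⟨γ₀, hγ₀, hloc⟩ := exists_isMIntegralCurveAt_of_contMDiffAt_boundaryless (t₀ := 0)
    hX.contMDiffAt (x₀ := (1 : G))
  obtain ⟨ε, hε, hloc⟩ := isMIntegralCurveAt_iff'.1 hloc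
  rw [Real.ball_eq_Ioo, zero_sub, zero_add] at hloc
  obtain ⟨γ, hγ0, hγ⟩ := exists_isMIntegralCurve_of_isMIntegralCurveOn hX hε
    (fun g => ⟨fun t => g * γ₀ t, by simp [hγ₀], hloc.const_mul g⟩) (1 : G)
  have hmul : ∀ s t, γ (s + t) = γ s * γ t := by
    intro s t
    have h1 : IsMIntegralCurve (fun t => γ s * γ t) X := by
      rw [isMIntegralCurve_iff_isMIntegralCurveOn] at hγ ⊢
      exact hγ.const_mul (γ s)
    have h2 : IsMIntegralCurve (γ ∘ (· + s)) X := hγ.comp_add s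
    have := isMIntegralCurve_Ioo_eq_of_contMDiff_boundaryless hX h2 h1 (t₀ := 0)
      (by simp [hγ0])
    have := congrFun this t
    simpa [add_comm s t] using this
  have hd : HasDerivAt (fun t => oneChart E G (γ t)) v 0 := by
    have h := (hγ.isMIntegralCurveAt 0).eventually_hasDerivAt.self_of_nhds
    replace h := HasDerivAt.congr_deriv (F := E) h (g' := X (γ 0))
      (tangentCoordChange_self (I := 𝓘(ℝ, E)) (mem_extChartAt_source (γ 0)))
    have hX1 : X (γ 0) = v := by
      rw [hγ0]
      have : (fun x : G => 1 * x) = id := by ext; simp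
      simp only [X, mulInvariantVectorField]
      rw [this, mfderiv_id]
      rfl
    replace h := h.congr_deriv hX1
    rwa [hγ0] at h
  have hcont : Continuous γ := continuous_iff_continuousAt.2 fun t => (hγ t).continuousAt
  exact ⟨γ, contMDiff_of_map_add_of_hasDerivAt_zero hmul hcont hd, hmul, hd⟩

end OneParameter

/-! ### The exponential map of a commutative Lie group -/

section Exponential

variable {E : Type*} [NormedAddCommGroup E] [NormedSpace ℝ E]
  {G : Type*} [TopologicalSpace G] [ChartedSpace E G]

/-- `e` is a smooth homomorphism from the vector space `E` to the Lie group `G`, with a local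
inverse `s` at the identity that is smooth at the identity. -/
structure IsExponential [Group G] (e : E → G) (s : G → E) : Prop where
  contMDiff : ContMDiff 𝓘(ℝ, E) 𝓘(ℝ, E) ∞ e
  map_add : ∀ x y, e (x + y) = e x * e y
  contMDiffAt_symm : ContMDiffAt 𝓘(ℝ, E) 𝓘(ℝ, E) ∞ s 1
  symm_one : s 1 = 0
  right_inv : ∀ᶠ g in 𝓝 1, e (s g) = g
  left_inv : ∀ᶠ x in 𝓝 0, s (e x) = x

/-- By commutativity, the product of the one-parameter subgroups in the directions of a basis is
a homomorphism; its derivative at the origin is the identity. -/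
theorem exists_isExponential [CommGroup G] [LieGroup 𝓘(ℝ, E) ∞ G] [FiniteDimensional ℝ E] :
    ∃ (e : E → G) (s : G → E), IsExponential e s := by
  have : CompleteSpace E := FiniteDimensional.complete ℝ E
  let b := Module.finBasis ℝ E
  choose γ hγs hγm hγd using fun i => exists_oneParameterSubgroup (G := G) (b i)
  have hγ0 : ∀ i, γ i 0 = 1 := fun i => by
    have := hγm i 0 0
    rw [add_zero] at this
    exact left_eq_mul.1 this
  let e : E → G := fun x => ∏ i, γ i (b.coord i x)
  have hes : ContMDiff 𝓘(ℝ, E) 𝓘(ℝ, E) ∞ e := by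
    refine contMDiff_finsetProd fun i _ => (hγs i).comp ?_
    exact (LinearMap.toContinuousLinearMap (b.coord i)).contDiff.contMDiff
  have hem : ∀ x y, e (x + y) = e x * e y := fun x y => by
    simp only [e, map_add, hγm, Finset.prod_mul_distrib]
  have he0 : e 0 = 1 := by simp [e, hγ0]
  set φ := oneChart E G
  have hf : ContDiffAt ℝ ∞ (fun x => φ (e x)) 0 := by
    rw [← contMDiffAt_iff_contDiffAt]
    refine ContMDiffAt.comp (g := φ) (0 : E) ?_ hes.contMDiffAt
    rw [he0]
    exact contMDiffAt_oneChart one_mem_oneChart_source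
  have hfd := (hf.differentiableAt (by simp)).hasFDerivAt
  have hfid : fderiv ℝ (fun x => φ (e x)) 0 = ContinuousLinearMap.id ℝ E := by
    refine ContinuousLinearMap.coe_injective (b.ext fun j => ?_)
    have h1 : HasDerivAt (fun t : ℝ => t • b j) (b j) 0 := by
      simpa using (hasDerivAt_id (0 : ℝ)).smul_const (b j)
    have h2 : HasDerivAt (fun t : ℝ => φ (e (t • b j)))
        (fderiv ℝ (fun x => φ (e x)) 0 (b j)) 0 := by
      refine HasFDerivAt.comp_hasDerivAt (l := fun x => φ (e x)) (0 : ℝ) ?_ h1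
      simpa using hfd
    have h3 : (fun t : ℝ => φ (e (t • b j))) = fun t => φ (γ j t) := by
      funext t
      congr 1
      simp only [e]
      rw [Finset.prod_eq_single j]
      · simp
      · intro i _ hij
        simp [hij.symm, hγ0]
      · simp
    rw [h3] at h2
    exact h2.unique (hγd j)
  have hfd' : HasFDerivAt (fun x => φ (e x))
      ((ContinuousLinearEquiv.refl ℝ E : E ≃L[ℝ] E) : E →L[ℝ] E) 0 := by
    rw [hfid] at hfd
    exact hfd
  have hstrict := hf.hasStrictFDerivAt' hfd' (by simp)
  let r := hf.localInverse hfd' (by simp)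
  have hr : ContDiffAt ℝ ∞ r (φ (e 0)) := hf.to_localInverse hfd' (by simp)
  have hφ : ContMDiffAt 𝓘(ℝ, E) 𝓘(ℝ, E) ∞ φ 1 := contMDiffAt_oneChart one_mem_oneChart_source
  have hr1 : r (φ 1) = 0 := by
    have := hf.localInverse_apply_image hfd' (by simp)
    rwa [he0] at this
  rw [he0] at hr
  refine ⟨e, fun g => r (φ g), hes, hem, ?_, hr1, ?_, hstrict.eventually_left_inverse⟩
  · exact hr.contMDiffAt.comp 1 hφ
  · have h1 := hstrict.eventually_right_inverse
    rw [he0] at h1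
    have h2 := hφ.continuousAt.eventually h1
    have h3 : Tendsto (fun g => e (r (φ g))) (𝓝 1) (𝓝 1) := by
      have hc : ContinuousAt (fun g => e (r (φ g))) 1 :=
        hes.continuous.continuousAt.comp (hr.continuousAt.comp hφ.continuousAt)
      have := hc.tendsto
      rwa [hr1, he0] at this
    have hsrc : φ.source ∈ 𝓝 (1 : G) :=
      isOpen_oneChart_source.mem_nhds one_mem_oneChart_source
    filter_upwards [h2, h3.eventually hsrc, hsrc] with g hg1 hg2 hg3
    exact φ.injOn hg2 hg3 hg1

namespace IsExponential

variable [Group G] {e : E → G} {s : G → E}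

theorem map_zero (h : IsExponential e s) : e 0 = 1 := by
  have := h.map_add 0 0
  rw [add_zero] at this
  exact left_eq_mul.1 this

theorem map_neg (h : IsExponential e s) (x : E) : e (-x) = (e x)⁻¹ := by
  rw [eq_inv_iff_mul_eq_one, ← h.map_add, neg_add_cancel, h.map_zero]

/-- The homomorphism `e`, with values in the additive version of `G`. -/
def toAddMonoidHom (h : IsExponential e s) : E →+ Additive G where
  toFun x := Additive.ofMul (e x)
  map_zero' := congrArg Additive.ofMul h.map_zero
  map_add' x y := congrArg Additive.ofMul (h.map_add x y)

/-- The kernel of an exponential map. -/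
def kernel (h : IsExponential e s) : Submodule ℤ E := h.toAddMonoidHom.ker.toIntSubmodule

theorem mem_kernel (h : IsExponential e s) {x : E} : x ∈ h.kernel ↔ e x = 1 := Iff.rfl

theorem map_eq_iff (h : IsExponential e s) {x y : E} : e x = e y ↔ e (x - y) = 1 := by
  rw [sub_eq_add_neg, h.map_add, h.map_neg, mul_inv_eq_one]

/-- Near the origin `e` is injective. -/
theorem discreteTopology_kernel (h : IsExponential e s) : DiscreteTopology h.kernel := by
  rw [discreteTopology_iff_isOpen_singleton_zero, isOpen_iff_mem_nhds]
  rintro _ rfl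
  have hc : Tendsto ((↑) : h.kernel → E) (𝓝 0) (𝓝 0) := continuous_subtype_val.tendsto 0
  filter_upwards [hc.eventually h.left_inv] with x hx
  rw [h.mem_kernel.1 x.2, h.symm_one] at hx
  exact Subtype.ext hx.symm

variable [LieGroup 𝓘(ℝ, E) ∞ G]

/-- Near the origin the local inverse `s` shows that `e` is open; elsewhere, translate. -/
theorem isOpenMap (h : IsExponential e s) : IsOpenMap e := by
  have : IsTopologicalGroup G := topologicalGroup_of_lieGroup 𝓘(ℝ, E) ∞
  rw [isOpenMap_iff_nhds_le]
  intro x U hU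
  have hs : Tendsto (fun g : G => x + s ((e x)⁻¹ * g)) (𝓝 (e x)) (𝓝 x) := by
    have h1 : Tendsto (fun g : G => (e x)⁻¹ * g) (𝓝 (e x)) (𝓝 1) := by
      have := (continuous_const_mul (e x)⁻¹).tendsto (e x)
      rwa [inv_mul_cancel] at this
    have h2 := h.contMDiffAt_symm.continuousAt.tendsto.comp h1
    rw [h.symm_one] at h2
    simpa using h2.const_add x
  have hr : ∀ᶠ g in 𝓝 (e x), e (x + s ((e x)⁻¹ * g)) = g := by
    have h1 : Tendsto (fun g : G => (e x)⁻¹ * g) (𝓝 (e x)) (𝓝 1) := by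
      have := (continuous_const_mul (e x)⁻¹).tendsto (e x)
      rwa [inv_mul_cancel] at this
    filter_upwards [h1.eventually h.right_inv] with g hg
    rw [h.map_add, hg, mul_inv_cancel_left]
  filter_upwards [hs.eventually hU, hr] with g hg1 hg2
  rw [← hg2]
  exact hg1

/-- The image is an open, hence closed, subgroup. -/
theorem surjective [ConnectedSpace G] (h : IsExponential e s) : Function.Surjective e := by
  have : IsTopologicalGroup G := topologicalGroup_of_lieGroup 𝓘(ℝ, E) ∞
  let R : Subgroup G :=
    { carrier := range e
      one_mem' := ⟨0, h.map_zero⟩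
      mul_mem' := by rintro _ _ ⟨x, rfl⟩ ⟨y, rfl⟩; exact ⟨x + y, h.map_add x y⟩
      inv_mem' := by rintro _ ⟨x, rfl⟩; exact ⟨-x, h.map_neg x⟩ }
  have hopen : IsOpen (R : Set G) := h.isOpenMap.isOpen_range
  have : (R : Set G) = univ :=
    IsClopen.eq_univ ⟨R.isClosed_of_isOpen hopen, hopen⟩ ⟨1, R.one_mem⟩
  exact range_eq_univ.1 this

/-- By compactness, a ball meets every coset of the kernel, so that a linear form that vanishes on
the kernel is bounded. -/
theorem span_kernel [FiniteDimensional ℝ E] [CompactSpace G] [ConnectedSpace G]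
    (h : IsExponential e s) : Submodule.span ℝ (h.kernel : Set E) = ⊤ := by
  obtain ⟨R, hR⟩ : ∃ R : ℕ, e '' Metric.ball 0 R = univ := by
    have hcover : (univ : Set G) ⊆ ⋃ k : ℕ, e '' Metric.ball 0 k := by
      intro g _
      obtain ⟨x, rfl⟩ := h.surjective g
      obtain ⟨k, hk⟩ := exists_nat_gt ‖x‖
      exact mem_iUnion.2 ⟨k, x, by simpa using hk, rfl⟩
    obtain ⟨k, hk⟩ := isCompact_univ.elim_directed_cover _
      (fun k : ℕ => h.isOpenMap _ Metric.isOpen_ball) hcover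
      (Monotone.directed_le fun a b hab => image_mono
        (Metric.ball_subset_ball (by exact_mod_cast hab)))
    exact ⟨k, univ_subset_iff.1 hk⟩
  by_contra hne
  obtain ⟨v, hv⟩ : ∃ v, v ∉ Submodule.span ℝ (h.kernel : Set E) := by
    by_contra! hall
    exact hne (eq_top_iff.2 fun x _ => hall x)
  obtain ⟨l, hlv, hl⟩ := Submodule.exists_le_ker_of_notMem hv
  let l' := LinearMap.toContinuousLinearMap l
  have hbound : ∀ x, ‖l x‖ ≤ ‖l'‖ * R := by
    intro x
    obtain ⟨y, hy, hyx⟩ : e x ∈ e '' Metric.ball 0 (R : ℝ) := hR ▸ mem_univ _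
    have hk : x - y ∈ h.kernel := h.mem_kernel.2 (h.map_eq_iff.1 hyx.symm)
    have h0 : l (x - y) = 0 := hl (Submodule.subset_span hk)
    rw [map_sub, sub_eq_zero] at h0
    rw [h0]
    refine (l'.le_opNorm y).trans ?_
    gcongr
    simpa using (Metric.mem_ball.1 hy).le
  have h1 := hbound (((‖l'‖ * R + 1) / l v) • v)
  rw [map_smul, smul_eq_mul, div_mul_cancel₀ _ hlv] at h1
  have h2 := (Real.le_norm_self (‖l'‖ * R + 1)).trans h1
  linarith

/-- The kernel is a lattice: in suitable coordinates it consists of the integral vectors. -/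
theorem exists_basis_kernel [FiniteDimensional ℝ E] [CompactSpace G] [ConnectedSpace G]
    (h : IsExponential e s) : ∃ b : Module.Basis (Fin (Module.finrank ℝ E)) ℝ E,
      ∀ x, e x = 1 ↔ ∀ i, ∃ k : ℤ, (k : ℝ) = b.repr x i := by
  have := h.discreteTopology_kernel
  have : IsZLattice ℝ h.kernel := ⟨h.span_kernel⟩
  have : Module.Finite ℤ h.kernel := ZLattice.module_finite ℝ h.kernel
  have : Module.Free ℤ h.kernel := ZLattice.module_free ℝ h.kernel
  let b₀ : Module.Basis (Fin (Module.finrank ℝ E)) ℤ h.kernel :=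
    Module.finBasisOfFinrankEq ℤ h.kernel (ZLattice.rank ℝ h.kernel)
  refine ⟨b₀.ofZLatticeBasis ℝ h.kernel, fun x => ?_⟩
  rw [← h.mem_kernel]
  nth_rewrite 1 [← b₀.ofZLatticeBasis_span ℝ h.kernel]
  rw [Module.Basis.mem_span_iff_repr_mem]
  rfl

end IsExponential

end Exponential

/-! ### The torus as a product manifold -/

section PiManifold

variable {ι : Type*} [Fintype ι] {F : ι → Type*} [∀ i, NormedAddCommGroup (F i)]
  [∀ i, NormedSpace ℝ (F i)] {H : ι → Type*} [∀ i, TopologicalSpace (H i)]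
  {I : ∀ i, ModelWithCorners ℝ (F i) (H i)} {M : ι → Type*} [∀ i, TopologicalSpace (M i)]
  [∀ i, ChartedSpace (H i) (M i)]
  {V : Type*} [NormedAddCommGroup V] [NormedSpace ℝ V] {K : Type*} [TopologicalSpace K]
  {J : ModelWithCorners ℝ V K} {N : Type*} [TopologicalSpace N] [ChartedSpace K N]

/-- A map into a finite product of manifolds is smooth if its components are. -/
theorem contMDiff_pi_of_forall {n : WithTop ℕ∞} {f : N → ∀ i, M i}
    (hf : ∀ i, ContMDiff J (I i) n fun x => f x i) :
    ContMDiff J (ModelWithCorners.pi I) n f := by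
  intro x
  rw [contMDiffAt_iff]
  refine ⟨continuousAt_pi.2 fun i => (hf i).continuous.continuousAt, ?_⟩
  rw [contDiffWithinAt_pi]
  exact fun i => (contMDiffAt_iff.1 (hf i x)).2

theorem contMDiff_eval_pi (n : WithTop ℕ∞) (i : ι) :
    ContMDiff (ModelWithCorners.pi I) (I i) n fun x : ∀ i, M i => x i := by
  intro x
  rw [contMDiffAt_iff]
  refine ⟨(continuous_apply i).continuousAt, ?_⟩
  have h : ContDiffWithinAt ℝ n (fun y : ∀ i, F i => y i) (range (ModelWithCorners.pi I))
      (extChartAt (ModelWithCorners.pi I) x x) :=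
    (ContinuousLinearMap.proj (R := ℝ) (φ := F) i).contDiff.contDiffWithinAt
  refine h.congr_of_eventuallyEq_of_mem ?_ (mem_range_self _)
  filter_upwards [extChartAt_target_mem_nhdsWithin (I := ModelWithCorners.pi I) x] with y hy
  exact (extChartAt (I i) (x i)).right_inv ⟨hy.1 i (mem_univ i), hy.2 i (mem_univ i)⟩

end PiManifold

/-! ### Smooth homomorphisms and the argument on the circle -/

theorem contMDiffAt_circle_arg_one :
    ContMDiffAt (𝓡 1) 𝓘(ℝ, ℝ) ∞ (fun z : Circle => Complex.arg (z : ℂ)) 1 := by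
  have : Fact (Module.finrank ℝ ℂ = 1 + 1) := Complex.finrank_real_complex_fact
  have h1 : ContMDiff (𝓡 1) 𝓘(ℝ, ℂ) ∞ (fun z : Circle => (z : ℂ)) :=
    contMDiff_coe_sphere (E := ℂ) (n := 1)
  have h2 : ContDiffAt ℝ ∞ (fun z : ℂ => Complex.arg z) ((1 : Circle) : ℂ) := by
    have hlog : ContDiffAt ℝ ∞ Complex.log ((1 : Circle) : ℂ) :=
      (Complex.contDiffAt_log (by simp)).restrict_scalars ℝ
    exact (Complex.imCLM.contDiff.contDiffAt.comp _ hlog).congr_of_eventuallyEq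
      (Eventually.of_forall fun z => (Complex.log_im z).symm)
  exact h2.contMDiffAt.comp 1 h1.contMDiffAt

/-- A homomorphism between Lie groups that is smooth at the identity is smooth. -/
theorem MonoidHom.contMDiff_of_contMDiffAt_one {E₁ E₂ H₁ H₂ G₁ G₂ : Type*}
    [NormedAddCommGroup E₁] [NormedSpace ℝ E₁] [NormedAddCommGroup E₂] [NormedSpace ℝ E₂]
    [TopologicalSpace H₁] [TopologicalSpace H₂] {I₁ : ModelWithCorners ℝ E₁ H₁}
    {I₂ : ModelWithCorners ℝ E₂ H₂} [TopologicalSpace G₁] [ChartedSpace H₁ G₁] [Group G₁]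
    [TopologicalSpace G₂] [ChartedSpace H₂ G₂] [Group G₂] {n : WithTop ℕ∞}
    [ContMDiffMul I₁ n G₁] [ContMDiffMul I₂ n G₂] (f : G₁ →* G₂)
    (h : ContMDiffAt I₁ I₂ n f 1) : ContMDiff I₁ I₂ n f := by
  intro x
  have h2 : ContMDiffAt I₁ I₂ n (fun y : G₁ => f (x⁻¹ * y)) x :=
    ContMDiffAt.comp (g := f) x (by simpa using h) contMDiffAt_mul_left
  refine ((contMDiffAt_const (c := f x)).mul h2).congr_of_eventuallyEq
    (Eventually.of_forall fun y => ?_)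
  change f y = f x * f (x⁻¹ * y)
  rw [← map_mul, mul_inv_cancel_left]

/-! ### Compact connected commutative Lie groups are tori -/

theorem Circle.exp_two_pi_mul_eq_one_iff {t : ℝ} :
    Circle.exp (2 * Real.pi * t) = 1 ↔ ∃ k : ℤ, (k : ℝ) = t := by
  rw [Circle.exp_eq_one]
  refine exists_congr fun k => ?_
  rw [mul_comm (k : ℝ), mul_right_inj' (by positivity), eq_comm]

/-- In coordinates adapted to the kernel lattice, `e` and the map
`x ↦ (exp (2πi x_j))_j` are surjective homomorphisms with the same kernel, so that `e x` and
`(exp (2πi x_j))_j` correspond to each other under an isomorphism. -/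
theorem exists_diffeomorph_torus {E : Type*} [NormedAddCommGroup E] [NormedSpace ℝ E]
    [FiniteDimensional ℝ E] {G : Type*} [TopologicalSpace G] [ChartedSpace E G] [CommGroup G]
    [LieGroup 𝓘(ℝ, E) ∞ G] [CompactSpace G] [ConnectedSpace G] :
    ∃ (n : ℕ) (φ : G ≃ₘ^∞⟮𝓘(ℝ, E), torusModel n⟯ Torus n), ∀ a b : G, φ (a * b) = φ a * φ b := by
  obtain ⟨e, s, he⟩ := exists_isExponential (E := E) (G := G)
  obtain ⟨n, b, hb⟩ : ∃ (n : ℕ) (b : Module.Basis (Fin n) ℝ E),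
      ∀ x, e x = 1 ↔ ∀ i, ∃ k : ℤ, (k : ℝ) = b.repr x i := ⟨_, he.exists_basis_kernel⟩
  let T : E → Torus n := fun x j => Circle.exp (2 * Real.pi * b.coord j x)
  have hT_add : ∀ x y, T (x + y) = T x * T y := fun x y => by
    funext j
    simp only [T, map_add, mul_add, Circle.exp_add, Pi.mul_apply]
  have hT_one : ∀ x, T x = 1 ↔ e x = 1 := fun x => by
    rw [hb, funext_iff]
    exact forall_congr' fun j => Circle.exp_two_pi_mul_eq_one_iff
  have hT_neg : ∀ x, T (-x) = (T x)⁻¹ := fun x => by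
    funext j
    simp only [T, _root_.map_neg, mul_neg, Circle.exp_neg, Pi.inv_apply]
  have hT_eq : ∀ x y, T x = T y ↔ e x = e y := fun x y => by
    rw [he.map_eq_iff, ← hT_one, sub_eq_add_neg, hT_add, hT_neg, mul_inv_eq_one]
  choose r hr using he.surjective
  -- the isomorphism, one coordinate at a time
  let φ : G →* Torus n :=
    { toFun := fun g => T (r g)
      map_one' := by rw [hT_one, hr]
      map_mul' := fun g h => by rw [← hT_add, hT_eq, he.map_add, hr, hr, hr] }
  have hφe : ∀ x, φ (e x) = T x := fun x => (hT_eq _ _).2 (hr _)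
  -- the branch of the argument does not matter, since `e` is trivial on the lattice
  let α : Fin n → Circle →* G := fun j =>
    { toFun := fun z => e ((Complex.arg (z : ℂ) / (2 * Real.pi)) • b j)
      map_one' := by simp [he.map_zero]
      map_mul' := fun z w => by
        rw [← he.map_add, ← hT_eq, hT_add]
        funext i
        by_cases hij : j = i
        · subst hij
          simp only [T, map_smul, Module.Basis.coord_apply, Module.Basis.repr_self,
            Finsupp.smul_single, Finsupp.single_eq_same, smul_eq_mul, mul_one, Pi.mul_apply,
            mul_div_cancel₀ _ Real.two_pi_pos.ne', Circle.exp_arg]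
        · simp [T, Finsupp.single_eq_of_ne (Ne.symm hij)] }
  let ψ : Torus n → G := fun z => ∏ j, α j (z j)
  have hφα : ∀ j z i, φ (α j z) i = if i = j then z else 1 := by
    intro j z i
    change φ (e ((Complex.arg (z : ℂ) / (2 * Real.pi)) • b j)) i = _
    rw [hφe]
    by_cases hij : i = j
    · subst hij
      simp [T, mul_div_cancel₀, Real.pi_ne_zero, Circle.exp_arg]
    · simp [T, hij]
  have hφψ : ∀ z, φ (ψ z) = z := by
    intro z
    funext i
    simp only [ψ, map_prod, Finset.prod_apply, hφα]
    simp
  have hφinj : Function.Injective φ := fun g h hgh => by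
    have := (hT_eq (r g) (r h)).1 hgh
    rwa [hr, hr] at this
  have hφsmooth : ContMDiff 𝓘(ℝ, E) (torusModel n) ∞ φ := by
    refine contMDiff_pi_of_forall fun j => ?_
    let φj : G →* Circle := (Pi.evalMonoidHom (fun _ : Fin n => Circle) j).comp φ
    refine φj.contMDiff_of_contMDiffAt_one ?_
    have h1 : ContMDiff 𝓘(ℝ, E) (𝓡 1) ∞ fun x : E => T x j := by
      refine contMDiff_circleExp.comp ?_
      exact (contDiff_const.mul
        (LinearMap.toContinuousLinearMap (b.coord j)).contDiff).contMDiff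
    refine (h1.contMDiffAt.comp (1 : G) he.contMDiffAt_symm).congr_of_eventuallyEq ?_
    filter_upwards [he.right_inv] with g hg
    change φ g j = T (s g) j
    rw [← hφe, hg]
  have hαsmooth : ∀ j, ContMDiff (𝓡 1) 𝓘(ℝ, E) ∞ (α j) := by
    intro j
    refine (α j).contMDiff_of_contMDiffAt_one ?_
    have h1 : ContDiff ℝ ∞ fun t : ℝ => (t / (2 * Real.pi)) • b j :=
      (contDiff_id.div_const _).smul contDiff_const
    exact (he.contMDiff.comp h1.contMDiff).contMDiffAt.comp (1 : Circle) contMDiffAt_circle_arg_one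
  have hψsmooth : ContMDiff (torusModel n) 𝓘(ℝ, E) ∞ ψ :=
    contMDiff_finsetProd fun j _ => (hαsmooth j).comp (contMDiff_eval_pi ∞ j)
  exact ⟨n,
    { toEquiv := ⟨φ, ψ, fun g => hφinj (hφψ (φ g)), hφψ⟩
      contMDiff_toFun := hφsmooth
      contMDiff_invFun := hψsmooth }, fun a c => map_mul φ a c⟩

/-! ### Lie skew braces -/

namespace SkewBrace

section Algebra

variable {G : Type*} [SkewBrace G]

theorem circ_one (a : G) : circ a 1 = a := by
  have h : circ a (1 * 1) = circ a 1 * a⁻¹ * circ a 1 := circ_mul a 1 1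
  rw [mul_one, mul_assoc, left_eq_mul, inv_mul_eq_one] at h
  exact h.symm

/-- The two groups have the same identity element. -/
theorem one_circ (b : G) : circ 1 b = b := by
  have h : (1 : G) = (circGroup : Group G).one :=
    (@one_mul G (circGroup : Group G).toMulOneClass 1).symm.trans
      (circ_one (circGroup : Group G).one)
  rw [h]
  exact @one_mul G (circGroup : Group G).toMulOneClass b

theorem lam_mul (a b c : G) : lam a (b * c) = lam a b * lam a c := by
  have h : circ a (b * c) = circ a b * a⁻¹ * circ a c := circ_mul a b c
  simp only [lam, h, mul_assoc]

theorem lam_one_left (b : G) : lam 1 b = b := by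
  simp [lam, one_circ]

/-- The map `λ_a` as an endomorphism of `(G, ·)`. -/
def lamHom (a : G) : G →* G :=
  MonoidHom.mk' (lam a) (lam_mul a)

end Algebra

section Topology

variable {G : Type*} [SkewBrace G] [TopologicalSpace G]

/-- The brackets are intersections of closed subgroups that contain the commutators of `(G, ·)`. -/
theorem closedDerivedSeries_le_derived [IsTopologicalGroup G] (n : ℕ) :
    closedDerivedSeries G n ≤ derived G n := by
  induction n with
  | zero => exact le_rfl
  | succ n ih =>
    refine le_sInf fun K hK => ?_
    refine Subgroup.topologicalClosure_minimal _ ?_ hK.1.isClosed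
    refine Subgroup.commutator_le.2 fun x hx y hy => hK.2 ⟨x, ih hx, y, ih hy, Or.inl ?_⟩
    exact commutatorElement_def x y

end Topology

end SkewBrace

/-- The group structure is an explicit argument, for use with the second operation of a brace. -/
theorem continuous_mul_of_lieGroup {E : Type*} [NormedAddCommGroup E] [NormedSpace ℝ E]
    {G : Type*} [TopologicalSpace G] [ChartedSpace E G] (g : Group G)
    (h : LieGroup 𝓘(ℝ, E) ∞ G) : Continuous fun p : G × G => g.mul p.1 p.2 :=
  (contMDiff_mul 𝓘(ℝ, E) ∞).continuous

theorem mainTheorem4 {E : Type*} [NormedAddCommGroup E] [NormedSpace ℝ E]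
    [FiniteDimensional ℝ E] {G : Type*} [TopologicalSpace G] [ChartedSpace E G]
    [SkewBrace G] [LieSkewBrace E G] [CompactSpace G] [ConnectedSpace G]
    (hG : SkewBrace.IsBraceSolvable G) :
    (∃ n : ℕ,
      (∃ φ : G ≃ₘ^∞⟮𝓘(ℝ, E), torusModel n⟯ Torus n,
        ∀ a b : G, φ (a * b) = φ a * φ b) ∧
      (∃ ψ : G ≃ₘ^∞⟮𝓘(ℝ, E), torusModel n⟯ Torus n,
        ∀ a b : G, ψ (SkewBrace.circ a b) = ψ a * ψ b)) ∧
    SkewBrace.IsTrivial G := by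
  have hLie : LieGroup 𝓘(ℝ, E) ∞ G := LieSkewBrace.lieGroup
  have : IsTopologicalGroup G := topologicalGroup_of_lieGroup 𝓘(ℝ, E) ∞
  have : T2Space G := t2Space_of_lieGroup E G
  have hnss : NoSmallSubgroups G := noSmallSubgroups_of_lieGroup E G
  obtain ⟨m, hm⟩ := hG
  have hcomm : ∀ a b : G, a * b = b * a :=
    hnss.mul_comm_of_closedDerivedSeries_eq_bot (n := m)
      (eq_bot_iff.2 (hm ▸ SkewBrace.closedDerivedSeries_le_derived m))
  have hcirc : Continuous fun p : G × G => SkewBrace.circ p.1 p.2 :=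
    continuous_mul_of_lieGroup SkewBrace.circGroup (LieSkewBrace.lieGroup_circ (E := E))
  have htriv : SkewBrace.IsTrivial G := by
    intro a b
    have hlam : SkewBrace.lamHom a = SkewBrace.lamHom 1 :=
      hnss.monoidHom_eq SkewBrace.lamHom (continuous_fst.inv.mul hcirc)
        (fun _ _ _ _ => hcomm _ _) a 1
    have h : a⁻¹ * SkewBrace.circ a b = b :=
      (DFunLike.congr_fun hlam b).trans (SkewBrace.lam_one_left b)
    exact inv_mul_eq_iff_eq_mul.1 h
  let cg : CommGroup G := { (inferInstance : Group G) with mul_comm := hcomm }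
  obtain ⟨n, φ, hφ⟩ := @exists_diffeomorph_torus E _ _ _ G _ _ cg hLie _ _
  exact ⟨⟨n, ⟨φ, hφ⟩, φ, fun a b => by rw [htriv a b]; exact hφ a b⟩, htriv⟩
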